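/- Let $M$ be a compact metric space and let $h\colon M\to M$ be a minimal homeomorphism (that is, the only closed sets $K\subset M$ with $h(K)=K$ are $\varnothing$ and $M$). Let $C^*(\mathbf Z,M,h)$ be the transformation group C*-algebra, i.e. the universal unital C*-algebra generated by $C(M)$ and a unitary $u$ with $ufu^*=f\circ h^{-1}$ for all $f\in C(M)$. Let $Y\subset M$ be closed with $\operatorname{int}(Y)\neq\varnothing$, and let $$A(Y)=C^*\bigl(C(M),\,u\,C_0(M\setminus Y)\bigr)\subset C^*(\mathbf Z,M,h)$$ be the C*-subalgebra generated by $C(M)$ and all elements $uf$ with $f\in C_0(M\setminus Y)$, where $C_0(M\setminus Y)$ is identified with $\{f\in C(M): f|_Y=0\}$. For $x\in Y$ let $\lambda(x)$ be the smallest integer $n\ge 1$ with $h^n(x)\in Y$ ($\lambda(x)=\infty$ if there is none). Then $\lambda$ takes only finitely many values on $Y$, all of them finite; let $n(0)<n(1)<\cdots<n(l)$ be these values, and put $$Y_k=\overline{\{x\in Y:\lambda(x)=n(k)\}}\qquad(0\le k\le l).$$ Let $s_k\in M_{n(k)}\subset C(Y_k,M_{n(k)})$ be the cyclic shift matrix,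 with entries $1$ in the positions $(j+1,j)$ for $1\le j<n(k)$ and in the position $(1,n(k))$, and all other entries $0$ (so $s_k=1$ if $n(k)=1$). Then there exists a unique (not necessarily unital) $*$-homomorphism $$\gamma_Y\colon A(Y)\to\bigoplus_{k=0}^{l}C\bigl(Y_k,M_{n(k)}\bigr)$$ such that, for all $0\le k\le l$, $$\gamma_Y(f)_k=\operatorname{diag}\bigl(f\circ h|_{Y_k},\,f\circ h^2|_{Y_k},\,\dots,\,f\circ h^{n(k)}|_{Y_k}\bigr)\quad\text{for every } f\in C(M),$$ and $$\gamma_Y(uf)_k=s_k\,\gamma_Y(f)_k\quad\text{for every } f\in C_0(M\setminus Y).$$ Moreover, $\gamma_Y$ is unital and injective. -/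

import Mathlib

open scoped ENNReal

noncomputable section

namespace MinimalCrossedProduct

universe u

/-- A homeomorphism is minimal if it has no closed invariant subsets other than `∅` and the
whole space. -/
def IsMinimalHomeo {M : Type u} [TopologicalSpace M] (h : M ≃ₜ M) : Prop :=
  ∀ K : Set M, IsClosed K → h '' K = K → K = ∅ ∨ K = Set.univ

/-- The first return time of `x` to `Y`: the least `n ≥ 1` with `h ^ n (x) ∈ Y`, and `∞` if there
is no such `n`. -/
def firstReturnTime {M : Type u} [TopologicalSpace M] (h : M ≃ₜ M) (Y : Set M) (x : M) : ℕ∞ :=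
  sInf ((fun n : ℕ => (n : ℕ∞)) '' {n : ℕ | 1 ≤ n ∧ h^[n] x ∈ Y})

/-- The closure of `{x ∈ Y : λ(x) = m}`, the base of the tower of height `m`. -/
def towerBase {M : Type u} [TopologicalSpace M] (h : M ≃ₜ M) (Y : Set M) (m : ℕ) : Set M :=
  closure {x | x ∈ Y ∧ firstReturnTime h Y x = (m : ℕ∞)}

/-- The cyclic shift matrix `s` of size `m`, with ones just below the diagonal and in the upper
right corner. Rows and columns are numbered from `0`. -/
def shiftMatrix (m : ℕ) : Matrix (Fin m) (Fin m) ℂ :=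
  Matrix.of fun i j => if (i : ℕ) = ((j : ℕ) + 1) % m then 1 else 0

section CrossedProduct

variable {M : Type u} [TopologicalSpace M] [CompactSpace M]

/-- A covariant pair for `h`: a unital homomorphism `φ` from `C(M)` to a nonzero unital C⋆-algebra
and a unitary `v` in it such that `v φ(f) v⋆ = φ(f ∘ h⁻¹)` for all `f`. -/
structure CovariantPair (h : M ≃ₜ M) : Type (u + 1) where
  /-- the C⋆-algebra in which the pair lives -/
  Alg : Type u
  [cstar : CStarAlgebra Alg]
  [nontriv : Nontrivial Alg]
  /-- the homomorphism on functions -/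
  φ : C(M, ℂ) →⋆ₐ[ℂ] Alg
  /-- the unitary -/
  v : Alg
  v_mem : v ∈ unitary Alg
  covariant : ∀ f : C(M, ℂ), v * φ f * star v = φ (f.comp (h.symm : C(M, M)))

attribute [instance] CovariantPair.cstar CovariantPair.nontriv

/-- The C⋆-algebra of bounded families indexed by all covariant pairs. -/
abbrev BoundedFamilies (h : M ≃ₜ M) : Type (u + 1) :=
  lp (fun p : CovariantPair h => p.Alg) ∞

/-- A function on `M`, in all covariant pairs simultaneously. -/
def univFun (h : M ≃ₜ M) (f : C(M, ℂ)) : BoundedFamilies h :=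
  ⟨fun p => p.φ f, memℓp_infty ⟨‖f‖, by
    rintro _ ⟨p, rfl⟩
    exact NonUnitalStarAlgHom.norm_apply_le p.φ f⟩⟩

/-- The unitary of all covariant pairs simultaneously. -/
def univUnitary (h : M ≃ₜ M) : BoundedFamilies h :=
  ⟨fun p => p.v, memℓp_infty ⟨1, by
    rintro _ ⟨p, rfl⟩
    exact (CStarRing.norm_of_mem_unitary p.v_mem).le⟩⟩

/-- The (full) transformation group C⋆-algebra `C⋆(ℤ, M, h)`: the universal C⋆-algebra generated
by `C(M)` and a unitary `u` with `u f u⋆ = f ∘ h⁻¹`, realized as the closed ⋆-subalgebra generated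
by the universal covariant pair (so the norm of a ⋆-polynomial in `C(M)` and `u` is the supremum
of its norms over all covariant pairs). -/
def crossedProduct (h : M ≃ₜ M) : StarSubalgebra ℂ (BoundedFamilies h) :=
  (StarAlgebra.adjoin ℂ (Set.range (univFun h) ∪ {univUnitary h})).topologicalClosure

/-- The copy of `f ∈ C(M)` in the crossed product. -/
def ofFun (h : M ≃ₜ M) (f : C(M, ℂ)) : crossedProduct h :=
  ⟨univFun h f, StarSubalgebra.le_topologicalClosure _
    (StarAlgebra.subset_adjoin ℂ _ (Or.inl ⟨f, rfl⟩))⟩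

/-- The implementing unitary `u` of the crossed product. -/
def implUnitary (h : M ≃ₜ M) : crossedProduct h :=
  ⟨univUnitary h, StarSubalgebra.le_topologicalClosure _
    (StarAlgebra.subset_adjoin ℂ _ (Or.inr rfl))⟩

/-- `A(Y) = C⋆(C(M), u C₀(M \ Y))`, the closed ⋆-subalgebra of the crossed product generated by
`C(M)` and all `u f` with `f ∈ C(M)` vanishing on `Y`. -/
def orbitBreaking (h : M ≃ₜ M) (Y : Set M) : StarSubalgebra ℂ (crossedProduct h) :=
  (StarAlgebra.adjoin ℂ (Set.range (ofFun h) ∪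
    {a | ∃ f : C(M, ℂ), (∀ y ∈ Y, f y = 0) ∧ a = implUnitary h * ofFun h f})).topologicalClosure

/-- `f ∈ C(M)` as an element of `A(Y)`. -/
def orbitBreaking.fn (h : M ≃ₜ M) (Y : Set M) (f : C(M, ℂ)) : orbitBreaking h Y :=
  ⟨ofFun h f, StarSubalgebra.le_topologicalClosure _
    (StarAlgebra.subset_adjoin ℂ _ (Or.inl ⟨f, rfl⟩))⟩

/-- `u f` as an element of `A(Y)`, for `f ∈ C(M)` vanishing on `Y`. -/
def orbitBreaking.ufn (h : M ≃ₜ M) (Y : Set M) (f : C(M, ℂ)) (hf : ∀ y ∈ Y, f y = 0) :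
    orbitBreaking h Y :=
  ⟨implUnitary h * ofFun h f, StarSubalgebra.le_topologicalClosure _
    (StarAlgebra.subset_adjoin ℂ _ (Or.inr ⟨f, hf, rfl⟩))⟩

end CrossedProduct

section Tower

variable {M : Type u} [TopologicalSpace M]

/-- The matrix-valued function `diag (f ∘ h, f ∘ h ^ 2, …, f ∘ h ^ m)` on the tower base of
height `m`. -/
def towerDiag (h : M ≃ₜ M) (Y : Set M) (m : ℕ) (f : C(M, ℂ)) :
    C(towerBase h Y m, Matrix (Fin m) (Fin m) ℂ) where
  toFun x := Matrix.diagonal fun j : Fin m => f (h^[(j : ℕ) + 1] (x : M))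
  continuous_toFun := Continuous.matrix_diagonal <| continuous_pi fun _ =>
    f.continuous.comp ((h.continuous.iterate _).comp continuous_subtype_val)

/-- The shift matrix as a constant function on the tower base of height `m`. -/
def towerShift (h : M ≃ₜ M) (Y : Set M) (m : ℕ) :
    C(towerBase h Y m, Matrix (Fin m) (Fin m) ℂ) :=
  ContinuousMap.const _ (shiftMatrix m)

end Tower

/-- The direct sum `⨁ₖ C(Yₖ, M_{n(k)})`, for `l + 1` tower heights `n(0), …, n(l)`. -/
abbrev TowerAlgebra {M : Type u} [TopologicalSpace M] (h : M ≃ₜ M) (Y : Set M) {l : ℕ}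
    (n : Fin (l + 1) → ℕ) : Type u :=
  (k : Fin (l + 1)) → C(towerBase h Y (n k), Matrix (Fin (n k)) (Fin (n k)) ℂ)

/-- The two formulas required of the homomorphism `γ` from `A(Y)`. -/
def IsTowerHom {M : Type u} [TopologicalSpace M] [CompactSpace M] (h : M ≃ₜ M) (Y : Set M) {l : ℕ}
    (n : Fin (l + 1) → ℕ) (γ : orbitBreaking h Y →⋆ₙₐ[ℂ] TowerAlgebra h Y n) : Prop :=
  (∀ (f : C(M, ℂ)) (k : Fin (l + 1)),
    γ (orbitBreaking.fn h Y f) k = towerDiag h Y (n k) f) ∧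
  (∀ (f : C(M, ℂ)) (hf : ∀ y ∈ Y, f y = 0) (k : Fin (l + 1)),
    γ (orbitBreaking.ufn h Y f hf) k =
      towerShift h Y (n k) * γ (orbitBreaking.fn h Y f) k)

end MinimalCrossedProduct

end

open MinimalCrossedProduct

/-! For each point `x` the crossed product acts on ℓ²(ℤ): `f` multiplies the basis vector `e j` by
`f (h ^ j x)`, and `u` sends `e j` to `e (j + 1)`. The algebra `A(Y)` is the closed span of
monomials `u ^ k f` with `f` supported where the orbit segment of length `k` does not cross `Y`
(`adjoin_le_span_linkedMonomials`). Hence, if `x` and `h ^ n x` lie in `Y`, the span of `e 1, …, e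
n` is invariant under `A(Y)` (`orbitCoeff_eq_zero`), and compressing to it is multiplicative. These
compressions, continuous in `x`, form `towerHom`.

Injectivity rests on the uniform bound `N` on return times given by minimality and compactness. A
linked monomial with `|k| > N` vanishes, so a combination of them is a sum of `2N + 1` terms `u ^ k
g k`. Every nonzero value of `g k` is a matrix coefficient inside some tower, so the norm is at most
`2N + 1` times the largest such coefficient (`norm_le_of_mem_span`). If `γ a = 0`, approximants of
`a` have small tower coefficients, hence small norm. Uniqueness is automatic continuity plus
density. -/

noncomputable section

namespace MinimalCrossedProduct

universe u

/-! ### Return times and orbit segments avoiding `Y` -/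

section Dynamics

variable {M : Type u} [TopologicalSpace M] {h : M ≃ₜ M} {Y : Set M}

theorem zpow_natCast_apply (h : M ≃ₜ M) (n : ℕ) (x : M) : (h ^ (n : ℤ)) x = h^[n] x := by
  induction n generalizing x with
  | zero => rfl
  | succ n ih =>
    rw [Function.iterate_succ_apply, ← ih (h x), Nat.cast_succ, zpow_add, zpow_one]
    rfl

theorem zpow_add_apply (h : M ≃ₜ M) (m n : ℤ) (x : M) : (h ^ (m + n)) x = (h ^ m) ((h ^ n) x) := by
  rw [zpow_add]; rfl

/-- The orbit segment between `z` and `h ^ k (z)` does not cross `Y`, so that both points lie in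
the same tower over `Y`. -/
def Linked (h : M ≃ₜ M) (Y : Set M) (z : M) (k : ℤ) : Prop :=
  ∀ l : ℤ, min 0 k ≤ l → l < max 0 k → (h ^ l) z ∉ Y

theorem Linked.zero (z : M) : Linked h Y z 0 := fun l h1 h2 => by
  simp at h1 h2; omega

theorem Linked.one {z : M} (hz : z ∉ Y) : Linked h Y z 1 := fun l h1 h2 => by
  obtain rfl : l = 0 := by simp at h1 h2; omega
  simpa using hz

/-- The combined segment is covered by the two given ones, whatever the signs. This is what closes
linked monomials under products. -/
theorem Linked.add {z : M} {k m : ℤ} (hk : Linked h Y ((h ^ m) z) k) (hm : Linked h Y z m) :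
    Linked h Y z (k + m) := fun l h1 h2 => by
  by_cases hl : min 0 m ≤ l ∧ l < max 0 m
  · exact hm l hl.1 hl.2
  · have := hk (l - m) (by omega) (by omega)
    rwa [← zpow_add_apply, sub_add_cancel] at this

theorem Linked.neg {z : M} {k : ℤ} (hk : Linked h Y ((h ^ (-k)) z) k) : Linked h Y z (-k) :=
  fun l h1 h2 => by
    have := hk (l + k) (by omega) (by omega)
    rwa [← zpow_add_apply, add_neg_cancel_right] at this

theorem Linked.abs_le {N : ℕ} (hN : ∀ z, ∃ n : ℕ, 1 ≤ n ∧ n ≤ N ∧ (h ^ (n : ℤ)) z ∈ Y) {z : M}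
    {k : ℤ} (hk : Linked h Y z k) : |k| ≤ N := by
  by_contra! hlt
  rcases le_total 0 k with h0 | h0
  · obtain ⟨n, h1, h2, h3⟩ := hN z
    rw [abs_of_nonneg h0] at hlt
    exact hk n (by omega) (by omega) h3
  -- Starting `N + 1` steps back puts the visit to `Y` at a time between `-N` and `-1`, inside the
  -- segment.
  · obtain ⟨n, h1, h2, h3⟩ := hN ((h ^ (-(N + 1) : ℤ)) z)
    rw [← zpow_add_apply] at h3
    rw [abs_of_nonpos h0] at hlt
    exact hk _ (by omega) (by omega) h3

/-- Leaving the levels `1, …, n` downwards crosses `x`, and leaving upwards crosses `h ^ n x`. That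
`n` be the first return is not needed, so limit points in a tower base are covered. -/
theorem Linked.mem_Icc {x : M} {n j k : ℤ} (hx : x ∈ Y) (hn : (h ^ n) x ∈ Y) (hj1 : 1 ≤ j)
    (hjn : j ≤ n) (hk : Linked h Y ((h ^ j) x) k) : 1 ≤ j + k ∧ j + k ≤ n := by
  constructor
  · by_contra! hlt
    refine hk (-j) (by omega) (by omega) ?_
    rwa [← zpow_add_apply, neg_add_cancel, zpow_zero]
  · by_contra! hlt
    refine hk (n - j) (by omega) (by omega) ?_
    rwa [← zpow_add_apply, sub_add_cancel]

theorem firstReturnTime_eq_coe_iff {x : M} {n : ℕ} :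
    firstReturnTime h Y x = n ↔
      1 ≤ n ∧ (h ^ (n : ℤ)) x ∈ Y ∧ ∀ m : ℕ, 1 ≤ m → (h ^ (m : ℤ)) x ∈ Y → n ≤ m := by
  simp only [zpow_natCast_apply]
  unfold firstReturnTime
  constructor
  · intro hn
    have hne : ((fun n : ℕ => (n : ℕ∞)) '' {n : ℕ | 1 ≤ n ∧ h^[n] x ∈ Y}).Nonempty := by
      by_contra hne
      rw [Set.not_nonempty_iff_eq_empty.1 hne, sInf_empty] at hn
      exact ENat.top_ne_natCast n hn
    obtain ⟨m, hm, hmn⟩ := csInf_mem hne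
    have hmn' : (m : ℕ∞) = n := hmn.trans hn
    obtain rfl : m = n := by exact_mod_cast hmn'
    refine ⟨hm.1, hm.2, fun m' h1 h2 => ?_⟩
    have := (sInf_le ⟨m', ⟨h1, h2⟩, rfl⟩ :
      sInf ((fun n : ℕ => (n : ℕ∞)) '' {n : ℕ | 1 ≤ n ∧ h^[n] x ∈ Y}) ≤ (m' : ℕ∞))
    rw [hn] at this
    exact_mod_cast this
  · rintro ⟨h1, h2, h3⟩
    refine le_antisymm (sInf_le ⟨n, ⟨h1, h2⟩, rfl⟩) (le_sInf ?_)
    rintro _ ⟨m, ⟨hm1, hm2⟩, rfl⟩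
    exact Nat.cast_le.2 (h3 m hm1 hm2)

/-- Under a minimal homeomorphism of a compact space every point enters a set with nonempty
interior within a uniformly bounded time. -/
theorem IsMinimalHomeo.exists_return_bound [CompactSpace M] (hmin : IsMinimalHomeo h)
    (hY : (interior Y).Nonempty) :
    ∃ N : ℕ, ∀ z, ∃ n : ℕ, 1 ≤ n ∧ n ≤ N ∧ (h ^ (n : ℤ)) z ∈ Y := by
  have hopen : ∀ k : ℤ, IsOpen ((h ^ k) ⁻¹' interior Y) := fun k =>
    isOpen_interior.preimage (h ^ k).continuous
  -- The complement of the union is closed and invariant, so minimality applies to it.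
  have hcover : (⋃ k : ℤ, (h ^ k) ⁻¹' interior Y) = Set.univ := by
    have hinv : h '' (⋃ k : ℤ, (h ^ k) ⁻¹' interior Y)ᶜ = (⋃ k : ℤ, (h ^ k) ⁻¹' interior Y)ᶜ := by
      ext y
      simp only [Set.mem_image, Set.mem_compl_iff, Set.mem_iUnion, Set.mem_preimage, not_exists]
      constructor
      · rintro ⟨x, hx, rfl⟩ k
        have := hx (k + 1)
        rwa [zpow_add_apply, zpow_one] at this
      · intro hy
        refine ⟨h.symm y, fun k => ?_, h.apply_symm_apply y⟩
        have := hy (k - 1)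
        rwa [zpow_sub, zpow_one] at this
    rcases hmin _ (isOpen_iUnion hopen).isClosed_compl hinv with h0 | h0
    · exact Set.compl_empty_iff.1 h0
    · obtain ⟨y, hy⟩ := hY
      have : y ∈ (⋃ k : ℤ, (h ^ k) ⁻¹' interior Y)ᶜ := h0 ▸ Set.mem_univ y
      exact absurd (Set.mem_iUnion.2 ⟨0, by simpa using hy⟩) this
  obtain ⟨t, ht⟩ := isCompact_univ.elim_finite_subcover _ hopen hcover.ge
  obtain ⟨R, hR⟩ : ∃ R : ℕ, ∀ k ∈ t, |k| ≤ (R : ℤ) := by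
    refine ⟨t.sup Int.natAbs, fun k hk => ?_⟩
    rw [Int.abs_eq_natAbs]
    exact_mod_cast Finset.le_sup (f := Int.natAbs) hk
  -- The finite subcover uses times in `[-R, R]`; applying it at `h ^ (R + 1) z` shifts them to `[1,
  -- 2R + 1]`.
  refine ⟨2 * R + 1, fun z => ?_⟩
  obtain ⟨k, hk, hkz⟩ := Set.mem_iUnion₂.1 (ht (Set.mem_univ ((h ^ (R + 1 : ℤ)) z)))
  have hkR := _root_.abs_le.1 (hR k hk)
  have := interior_subset hkz
  rw [← zpow_add_apply] at this
  refine ⟨(k + (R + 1)).toNat, by omega, by omega, ?_⟩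
  rwa [Int.toNat_of_nonneg (by omega)]

theorem exists_firstReturnTime_eq {N : ℕ}
    (hN : ∀ z, ∃ n : ℕ, 1 ≤ n ∧ n ≤ N ∧ (h ^ (n : ℤ)) z ∈ Y) (x : M) :
    ∃ n : ℕ, n ≤ N ∧ firstReturnTime h Y x = n := by
  classical
  obtain ⟨n, h1, h2, h3⟩ := hN x
  have hex : ∃ n : ℕ, 1 ≤ n ∧ (h ^ (n : ℤ)) x ∈ Y := ⟨n, h1, h3⟩
  refine ⟨Nat.find hex, (Nat.find_min' hex ⟨h1, h3⟩).trans h2, firstReturnTime_eq_coe_iff.2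
    ⟨(Nat.find_spec hex).1, (Nat.find_spec hex).2, fun m hm1 hm2 => Nat.find_min' hex ⟨hm1, hm2⟩⟩⟩

/-- Every point lies on some level of the tower over a point of `Y`. -/
theorem exists_eq_zpow_of_return {N : ℕ}
    (hN : ∀ z, ∃ n : ℕ, 1 ≤ n ∧ n ≤ N ∧ (h ^ (n : ℤ)) z ∈ Y) (z : M) :
    ∃ x ∈ Y, ∃ n j : ℕ, firstReturnTime h Y x = n ∧ 1 ≤ j ∧ j ≤ n ∧ z = (h ^ (j : ℤ)) x := by
  classical
  have hex : ∃ j : ℕ, 1 ≤ j ∧ (h ^ (-j : ℤ)) z ∈ Y := by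
    obtain ⟨n, h1, h2, h3⟩ := hN ((h ^ (-(N + 1) : ℤ)) z)
    refine ⟨N + 1 - n, by omega, ?_⟩
    rw [← zpow_add_apply] at h3
    convert h3 using 3
    omega
  obtain ⟨hj1, hj2⟩ := Nat.find_spec hex
  obtain ⟨n, -, hn⟩ := exists_firstReturnTime_eq hN ((h ^ (-(Nat.find hex) : ℤ)) z)
  refine ⟨_, hj2, n, Nat.find hex, hn, hj1, ?_, ?_⟩
  -- If the return came before reaching `z`, it would be a more recent visit to `Y`, against the
  -- minimal choice of `j`.
  · by_contra! hlt
    obtain ⟨h1, h2, -⟩ := firstReturnTime_eq_coe_iff.1 hn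
    refine Nat.find_min hex (m := Nat.find hex - n) (by omega) ⟨by omega, ?_⟩
    rw [← zpow_add_apply] at h2
    convert h2 using 3
    omega
  · rw [← zpow_add_apply, add_neg_cancel, zpow_zero]; rfl

end Dynamics

/-! ### Orbit representations on ℓ²(ℤ) and their matrix coefficients -/

section Representation

/-- The Hilbert space `ℓ²(ℤ)`, in an arbitrary universe. -/
abbrev OrbitSpace : Type u := lp (fun _ : ULift.{u} ℤ => ℂ) 2

theorem OrbitSpace.memℓp_translate (k : ℤ) (ξ : OrbitSpace.{u}) :
    Memℓp (E := fun _ : ULift.{u} ℤ => ℂ) (fun i => ξ ⟨i.down - k⟩) 2 :=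
  memℓp_gen <| ((Equiv.ulift.trans ((Equiv.subRight k).trans Equiv.ulift.symm)).summable_iff
    (f := fun i : ULift.{u} ℤ => ‖ξ i‖ ^ (2 : ℝ≥0∞).toReal)).2
      ((lp.memℓp ξ).summable (by norm_num))

/-- Translation of the coordinates of `ℓ²(ℤ)` by `k`. -/
def OrbitSpace.translate (k : ℤ) (ξ : OrbitSpace.{u}) : OrbitSpace.{u} :=
  ⟨fun i => ξ ⟨i.down - k⟩, OrbitSpace.memℓp_translate k ξ⟩

theorem OrbitSpace.translate_apply (k : ℤ) (ξ : OrbitSpace.{u}) (i : ULift.{u} ℤ) :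
    OrbitSpace.translate k ξ i = ξ ⟨i.down - k⟩ := rfl

theorem OrbitSpace.norm_translate (k : ℤ) (ξ : OrbitSpace.{u}) :
    ‖OrbitSpace.translate k ξ‖ = ‖ξ‖ := by
  rw [lp.norm_eq_tsum_rpow (by norm_num), lp.norm_eq_tsum_rpow (by norm_num)]
  congr 1
  exact (Equiv.ulift.trans ((Equiv.subRight k).trans Equiv.ulift.symm)).tsum_eq
    (fun i : ULift.{u} ℤ => ‖ξ i‖ ^ (2 : ℝ≥0∞).toReal)

/-- The bilateral shift of `ℓ²(ℤ)`. -/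
def OrbitSpace.shift : OrbitSpace.{u} ≃ₗᵢ[ℂ] OrbitSpace.{u} where
  toFun := OrbitSpace.translate 1
  invFun := OrbitSpace.translate (-1)
  left_inv ξ := by ext i; simp [OrbitSpace.translate_apply]
  right_inv ξ := by ext i; simp [OrbitSpace.translate_apply]
  map_add' ξ η := by ext i; simp [OrbitSpace.translate_apply]
  map_smul' c ξ := by ext i; simp [OrbitSpace.translate_apply]
  norm_map' := OrbitSpace.norm_translate 1

theorem OrbitSpace.shift_apply (ξ : OrbitSpace.{u}) (i : ULift.{u} ℤ) :
    OrbitSpace.shift ξ i = ξ ⟨i.down - 1⟩ := rfl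

variable {M : Type u} [TopologicalSpace M] [CompactSpace M]

/-- A continuous function acting on `ℓ²(ℤ)` through its values along the orbit of `x`. -/
def orbitMul (h : M ≃ₜ M) (x : M) (f : C(M, ℂ)) : OrbitSpace.{u} →L[ℂ] OrbitSpace.{u} :=
  have hle (ξ : OrbitSpace.{u}) (i : ULift.{u} ℤ) :
      ‖f ((h ^ i.down) x) * ξ i‖ ≤ ‖(‖f‖ : ℂ) • ξ i‖ := by
    rw [norm_mul, norm_smul, Complex.norm_real, norm_norm]
    exact mul_le_mul_of_nonneg_right (f.norm_coe_le_norm _) (norm_nonneg _)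
  LinearMap.mkContinuous
    { toFun ξ := ⟨fun i => f ((h ^ i.down) x) * ξ i,
        ((lp.memℓp ξ).const_smul (‖f‖ : ℂ)).mono' (hle ξ)⟩
      map_add' ξ η := by ext i; exact mul_add _ _ _
      map_smul' c ξ := by ext i; exact mul_left_comm _ _ _ } ‖f‖ fun ξ => by
    refine (lp.norm_mono (p := 2) (by norm_num) (y := (‖f‖ : ℂ) • ξ) (hle ξ)).trans ?_
    rw [norm_smul, Complex.norm_real, norm_norm]

theorem orbitMul_apply (h : M ≃ₜ M) (x : M) (f : C(M, ℂ)) (ξ : OrbitSpace.{u}) (i : ULift.{u} ℤ) :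
    orbitMul h x f ξ i = f ((h ^ i.down) x) * ξ i := rfl

/-- The representation of `C(M)` on `ℓ²(ℤ)` along the orbit of `x`. -/
def orbitMulHom (h : M ≃ₜ M) (x : M) :
    C(M, ℂ) →⋆ₐ[ℂ] (OrbitSpace.{u} →L[ℂ] OrbitSpace.{u}) where
  toFun := orbitMul h x
  map_one' := by ext ξ i; simp [orbitMul_apply]
  map_mul' f g := by ext ξ i; simp [orbitMul_apply, mul_assoc]
  map_zero' := by ext ξ i; simp [orbitMul_apply]
  map_add' f g := by ext ξ i; simp [orbitMul_apply, add_mul]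
  commutes' c := by ext ξ i; simp [orbitMul_apply, Algebra.algebraMap_eq_smul_one]
  map_star' f := by
    rw [ContinuousLinearMap.star_eq_adjoint]
    refine (ContinuousLinearMap.eq_adjoint_iff _ _).2 fun ξ η => ?_
    rw [lp.inner_eq_tsum, lp.inner_eq_tsum]
    refine tsum_congr fun i => ?_
    simp only [orbitMul_apply, ContinuousMap.star_apply, RCLike.inner_apply, map_mul,
      RCLike.star_def, RCLike.conj_conj]
    ring

instance : Nontrivial OrbitSpace.{u} :=
  ⟨lp.single 2 ⟨0⟩ 1, 0, fun h0 => by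
    have := congrArg (fun ξ : OrbitSpace.{u} => ξ ⟨0⟩) h0
    simp at this⟩

/-- The covariant pair on `ℓ²(ℤ)` given by the orbit of `x`. -/
def orbitPair (h : M ≃ₜ M) (x : M) : CovariantPair h where
  Alg := OrbitSpace.{u} →L[ℂ] OrbitSpace.{u}
  φ := orbitMulHom h x
  v := (Unitary.linearIsometryEquiv.symm OrbitSpace.shift :
    unitary (OrbitSpace.{u} →L[ℂ] OrbitSpace.{u}))
  v_mem := Subtype.property _
  covariant f := by
    set w := (Unitary.linearIsometryEquiv.symm OrbitSpace.shift :
      unitary (OrbitSpace.{u} →L[ℂ] OrbitSpace.{u}))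
    have key : (w : OrbitSpace.{u} →L[ℂ] OrbitSpace.{u}) * orbitMulHom h x f =
        orbitMulHom h x (f.comp (h.symm : C(M, M))) * (w : OrbitSpace.{u} →L[ℂ] OrbitSpace.{u}) := by
      ext ξ i
      change f ((h ^ (i.down - 1)) x) * ξ ⟨i.down - 1⟩ =
        f (h.symm ((h ^ i.down) x)) * ξ ⟨i.down - 1⟩
      rw [sub_eq_neg_add, zpow_add_apply, zpow_neg_one]
      rfl
    exact (congrArg (· * star (w : OrbitSpace.{u} →L[ℂ] OrbitSpace.{u})) key).trans <|
      (mul_assoc _ _ _).trans <| (congrArg _ w.2.2).trans (mul_one _)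

/-- The representation of the crossed product on `ℓ²(ℤ)` along the orbit of `x`. -/
def orbitRep (h : M ≃ₜ M) (x : M) :
    crossedProduct h →⋆ₐ[ℂ] (OrbitSpace.{u} →L[ℂ] OrbitSpace.{u}) where
  toFun a := (a : BoundedFamilies h).1 (orbitPair h x)
  map_one' := rfl
  map_mul' _ _ := rfl
  map_zero' := rfl
  map_add' _ _ := rfl
  commutes' _ := rfl
  map_star' _ := rfl

theorem norm_orbitRep_le (h : M ≃ₜ M) (x : M) (a : crossedProduct h) : ‖orbitRep h x a‖ ≤ ‖a‖ :=
  lp.norm_apply_le_norm ENNReal.top_ne_zero (a : BoundedFamilies h) (orbitPair h x)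

/-- The standard basis vector `e j` of `ℓ²(ℤ)`. -/
def OrbitSpace.basis (j : ℤ) : OrbitSpace.{u} := lp.single 2 ⟨j⟩ 1

theorem OrbitSpace.basis_apply (i j : ℤ) :
    (OrbitSpace.basis j : OrbitSpace.{u}) ⟨i⟩ = if i = j then 1 else 0 := by
  simp [OrbitSpace.basis, Pi.single_apply]

theorem OrbitSpace.norm_basis (j : ℤ) : ‖(OrbitSpace.basis j : OrbitSpace.{u})‖ = 1 := by
  simp [OrbitSpace.basis, lp.norm_single]

theorem OrbitSpace.inner_basis_left (i : ℤ) (ξ : OrbitSpace.{u}) :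
    inner ℂ (OrbitSpace.basis i) ξ = ξ ⟨i⟩ := by
  simp [OrbitSpace.basis, lp.inner_single_left]

theorem OrbitSpace.eq_sum_basis (s : Finset ℤ) (ξ : OrbitSpace.{u})
    (hξ : ∀ i ∉ s, ξ ⟨i⟩ = 0) : ξ = ∑ i ∈ s, ξ ⟨i⟩ • OrbitSpace.basis i := by
  ext i
  rw [lp.coeFn_sum, Finset.sum_apply]
  by_cases hi : i.down ∈ s
  · rw [Finset.sum_eq_single_of_mem i.down hi]
    · simp [OrbitSpace.basis]
    · intro j _ hj
      simp [OrbitSpace.basis, ULift.ext_iff, hj.symm]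
  · rw [hξ _ hi, Finset.sum_eq_zero]
    intro j hj
    simp [OrbitSpace.basis, ULift.ext_iff, (ne_of_mem_of_not_mem hj hi).symm]

theorem OrbitSpace.shift_basis (j : ℤ) :
    OrbitSpace.shift (OrbitSpace.basis j : OrbitSpace.{u}) = OrbitSpace.basis (j + 1) := by
  ext ⟨i⟩
  rw [OrbitSpace.shift_apply, OrbitSpace.basis_apply, OrbitSpace.basis_apply]
  simp [sub_eq_iff_eq_add]

/-- The matrix coefficient `⟪e i, π (a) e j⟫` of `a` in the representation `π` of the crossed
product on `ℓ²(ℤ)` along the orbit of `x`. -/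
def orbitCoeff (h : M ≃ₜ M) (x : M) (i j : ℤ) : crossedProduct h →ₗ[ℂ] ℂ where
  toFun a := orbitRep h x a (OrbitSpace.basis j) ⟨i⟩
  map_add' a b := by rw [map_add]; rfl
  map_smul' c a := by rw [map_smul]; rfl

theorem orbitCoeff_apply (h : M ≃ₜ M) (x : M) (i j : ℤ) (a : crossedProduct h) :
    orbitCoeff h x i j a = orbitRep h x a (OrbitSpace.basis j) ⟨i⟩ := rfl

theorem norm_orbitCoeff_le (h : M ≃ₜ M) (x : M) (i j : ℤ) (a : crossedProduct h) :
    ‖orbitCoeff h x i j a‖ ≤ ‖a‖ := by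
  refine (lp.norm_apply_le_norm (by norm_num) _ _).trans ?_
  refine ((orbitRep h x a).le_opNorm _).trans ?_
  rw [OrbitSpace.norm_basis, mul_one]
  exact norm_orbitRep_le h x a

theorem continuous_orbitCoeff (h : M ≃ₜ M) (x : M) (i j : ℤ) : Continuous (orbitCoeff h x i j) :=
  AddMonoidHomClass.continuous_of_bound (orbitCoeff h x i j) 1 fun a => by
    rw [one_mul]; exact norm_orbitCoeff_le h x i j a

theorem orbitCoeff_star (h : M ≃ₜ M) (x : M) (i j : ℤ) (a : crossedProduct h) :
    orbitCoeff h x i j (star a) = star (orbitCoeff h x j i a) := by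
  rw [orbitCoeff_apply, orbitCoeff_apply, ← OrbitSpace.inner_basis_left,
    ← OrbitSpace.inner_basis_left, map_star, ContinuousLinearMap.star_eq_adjoint,
    ContinuousLinearMap.adjoint_inner_right, RCLike.star_def, inner_conj_symm]

/-- Finite support of the `j`-th column of `b` makes matrix multiplication a finite sum, with no
convergence question. -/
theorem orbitCoeff_mul (h : M ≃ₜ M) (x : M) (i j : ℤ) (a b : crossedProduct h) (s : Finset ℤ)
    (hb : ∀ l ∉ s, orbitCoeff h x l j b = 0) :
    orbitCoeff h x i j (a * b) = ∑ l ∈ s, orbitCoeff h x i l a * orbitCoeff h x l j b := by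
  rw [orbitCoeff_apply, map_mul, mul_apply_eq_comp,
    OrbitSpace.eq_sum_basis s (orbitRep h x b _) hb, map_sum, lp.coeFn_sum, Finset.sum_apply]
  refine Finset.sum_congr rfl fun l _ => ?_
  rw [map_smul, lp.coeFn_smul, Pi.smul_apply, smul_eq_mul, mul_comm]
  rfl

theorem orbitRep_ofFun_basis (h : M ≃ₜ M) (x : M) (f : C(M, ℂ)) (j : ℤ) :
    orbitRep h x (ofFun h f) (OrbitSpace.basis j) = f ((h ^ j) x) • OrbitSpace.basis j := by
  ext ⟨i⟩
  change f ((h ^ i) x) * OrbitSpace.basis j ⟨i⟩ = f ((h ^ j) x) * OrbitSpace.basis j ⟨i⟩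
  rw [OrbitSpace.basis_apply]
  split_ifs with hij
  · rw [hij]
  · simp

/-- The implementing unitary as an element of the unitary group. -/
def unitaryGen (h : M ≃ₜ M) : unitary (crossedProduct h) :=
  ⟨implUnitary h, by
    constructor <;> apply Subtype.ext <;> apply lp.ext <;> funext p
    · exact p.v_mem.1
    · exact p.v_mem.2⟩

theorem orbitRep_unitaryGen_basis (h : M ≃ₜ M) (x : M) (j : ℤ) :
    orbitRep h x (unitaryGen h) (OrbitSpace.basis j) = OrbitSpace.basis (j + 1) :=
  OrbitSpace.shift_basis j

theorem orbitRep_zpow_basis (h : M ≃ₜ M) (x : M) (k j : ℤ) :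
    orbitRep h x (unitaryGen h ^ k : unitary (crossedProduct h)) (OrbitSpace.basis j) =
      OrbitSpace.basis (j + k) := by
  induction k generalizing j with
  | zero => simp
  | succ k ih =>
    rw [zpow_add_one, Submonoid.coe_mul, map_mul, mul_apply_eq_comp,
      orbitRep_unitaryGen_basis, ih]
    congr 1; ring
  | pred k ih =>
    have := ih (j - 1)
    rw [← sub_add_cancel (-(k : ℤ)) 1, zpow_add_one, Submonoid.coe_mul, map_mul,
      mul_apply_eq_comp, orbitRep_unitaryGen_basis, sub_add_cancel] at this
    rw [this]
    congr 1; ring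

theorem orbitCoeff_zpow_mul_ofFun (h : M ≃ₜ M) (x : M) (i j k : ℤ) (f : C(M, ℂ)) :
    orbitCoeff h x i j ((unitaryGen h ^ k : unitary (crossedProduct h)) * ofFun h f) =
      if i = j + k then f ((h ^ j) x) else 0 := by
  rw [orbitCoeff_apply, map_mul, mul_apply_eq_comp, orbitRep_ofFun_basis, map_smul,
    orbitRep_zpow_basis, lp.coeFn_smul, Pi.smul_apply, OrbitSpace.basis_apply]
  simp

/-- The inclusion of `C(M)` in the crossed product. -/
def ofFunHom (h : M ≃ₜ M) : C(M, ℂ) →⋆ₐ[ℂ] crossedProduct h where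
  toFun := ofFun h
  map_one' := Subtype.ext <| lp.ext <| funext fun p => map_one p.φ
  map_mul' f g := Subtype.ext <| lp.ext <| funext fun p => map_mul p.φ f g
  map_zero' := Subtype.ext <| lp.ext <| funext fun p => map_zero p.φ
  map_add' f g := Subtype.ext <| lp.ext <| funext fun p => map_add p.φ f g
  commutes' c := Subtype.ext <| lp.ext <| funext fun p => AlgHomClass.commutes p.φ c
  map_star' f := Subtype.ext <| lp.ext <| funext fun p => map_star p.φ f

theorem ofFunHom_apply (h : M ≃ₜ M) (f : C(M, ℂ)) : ofFunHom h f = ofFun h f := rfl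

theorem norm_ofFun_le (h : M ≃ₜ M) (f : C(M, ℂ)) : ‖ofFun h f‖ ≤ ‖f‖ :=
  lp.norm_le_of_forall_le (norm_nonneg f) fun p => NonUnitalStarAlgHom.norm_apply_le p.φ f

theorem unitaryGen_mul_ofFun (h : M ≃ₜ M) (f : C(M, ℂ)) :
    (unitaryGen h : crossedProduct h) * ofFun h f =
      ofFun h (f.comp (h.symm : C(M, M))) * unitaryGen h := by
  refine Subtype.ext <| lp.ext <| funext fun p => ?_
  change p.v * p.φ f = p.φ (f.comp (h.symm : C(M, M))) * p.v
  rw [← p.covariant f, mul_assoc, p.v_mem.1, mul_one]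

/-- Normal ordering: powers of `u` can always be collected on the left. -/
theorem ofFun_mul_zpow (h : M ≃ₜ M) (f : C(M, ℂ)) (k : ℤ) :
    ofFun h f * (unitaryGen h ^ k : unitary (crossedProduct h)) =
      (unitaryGen h ^ k : unitary (crossedProduct h)) *
        ofFun h (f.comp ((h ^ k : M ≃ₜ M) : C(M, M))) := by
  induction k generalizing f with
  | zero =>
    rw [zpow_zero, OneMemClass.coe_one, mul_one, one_mul]
    rfl
  | succ k ih =>
    rw [zpow_add_one, Submonoid.coe_mul, ← mul_assoc, ih, mul_assoc, mul_assoc,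
      unitaryGen_mul_ofFun]
    congr 3
    ext y
    change f ((h ^ (k : ℤ)) y) = f ((h ^ ((k : ℤ) + 1)) (h.symm y))
    rw [zpow_add_one]
    exact congrArg (fun z => f ((h ^ (k : ℤ)) z)) (h.apply_symm_apply y).symm
  | pred k ih =>
    have h1 : (unitaryGen h ^ (-(k : ℤ) - 1) : unitary (crossedProduct h)) * unitaryGen h =
        unitaryGen h ^ (-(k : ℤ)) := by rw [← zpow_add_one, sub_add_cancel]
    have h2 := ih f
    rw [← h1, Submonoid.coe_mul, ← mul_assoc, mul_assoc _ (unitaryGen h : crossedProduct h),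
      unitaryGen_mul_ofFun, ← mul_assoc] at h2
    have h3 := congrArg (· * star (unitaryGen h : crossedProduct h)) h2
    simp only [mul_assoc, (unitaryGen h).2.2, mul_one] at h3
    rw [h3]
    refine congrArg (fun g => _ * ofFun h g) ?_
    ext y
    change f ((h ^ (-(k : ℤ))) (h.symm y)) = f ((h ^ (-(k : ℤ) - 1)) y)
    rw [zpow_sub_one]
    rfl

end Representation

/-! ### `A(Y)` as the closed span of linked monomials -/

section LinkedMonomials

variable {M : Type u} [TopologicalSpace M] [CompactSpace M]

/-- The elements `u ^ k f` for which `f` vanishes wherever the orbit segment of length `k`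
crosses `Y`. -/
def linkedMonomials (h : M ≃ₜ M) (Y : Set M) : Set (crossedProduct h) :=
  {a | ∃ (k : ℤ) (f : C(M, ℂ)), (∀ z, f z ≠ 0 → Linked h Y z k) ∧
    a = (unitaryGen h ^ k : unitary (crossedProduct h)) * ofFun h f}

variable {h : M ≃ₜ M} {Y : Set M}

theorem ofFun_mem_linkedMonomials (f : C(M, ℂ)) : ofFun h f ∈ linkedMonomials h Y :=
  ⟨0, f, fun z _ => Linked.zero z, by rw [zpow_zero, OneMemClass.coe_one, one_mul]⟩

theorem mul_mem_linkedMonomials {a b : crossedProduct h} (ha : a ∈ linkedMonomials h Y)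
    (hb : b ∈ linkedMonomials h Y) : a * b ∈ linkedMonomials h Y := by
  obtain ⟨k, f, hf, rfl⟩ := ha
  obtain ⟨m, g, hg, rfl⟩ := hb
  refine ⟨k + m, f.comp ((h ^ m : M ≃ₜ M) : C(M, M)) * g, fun z hz => ?_, ?_⟩
  · exact (hf _ (left_ne_zero_of_mul hz)).add (hg _ (right_ne_zero_of_mul hz))
  · rw [zpow_add, Submonoid.coe_mul, ← ofFunHom_apply, ← ofFunHom_apply, ← ofFunHom_apply, map_mul,
      mul_assoc, mul_assoc, ← mul_assoc (ofFunHom h f), ofFunHom_apply, ofFun_mul_zpow, mul_assoc]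
    rfl

theorem star_mem_linkedMonomials {a : crossedProduct h} (ha : a ∈ linkedMonomials h Y) :
    star a ∈ linkedMonomials h Y := by
  obtain ⟨k, f, hf, rfl⟩ := ha
  refine ⟨-k, (star f).comp ((h ^ (-k) : M ≃ₜ M) : C(M, M)), fun z hz => ?_, ?_⟩
  · exact (hf _ (star_ne_zero.1 hz)).neg
  · rw [← ofFun_mul_zpow, star_mul, ← ofFunHom_apply, ← map_star, zpow_neg]
    rfl

theorem adjoin_le_span_linkedMonomials {a : crossedProduct h}
    (ha : a ∈ StarAlgebra.adjoin ℂ (Set.range (ofFun h) ∪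
      {a | ∃ f : C(M, ℂ), (∀ y ∈ Y, f y = 0) ∧ a = implUnitary h * ofFun h f})) :
    a ∈ Submodule.span ℂ (linkedMonomials h Y) := by
  induction ha using StarAlgebra.adjoin_induction with
  | mem a ha =>
    refine Submodule.subset_span ?_
    rcases ha with ⟨f, rfl⟩ | ⟨f, hf, rfl⟩
    · exact ofFun_mem_linkedMonomials f
    · refine ⟨1, f, fun z hz => Linked.one fun hzY => hz (hf z hzY), ?_⟩
      rw [zpow_one]
      rfl
  | algebraMap r =>
    rw [← AlgHomClass.commutes (ofFunHom h) r]
    exact Submodule.subset_span (ofFun_mem_linkedMonomials _)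
  | add a b _ _ ha hb => exact add_mem ha hb
  | mul a b _ _ ha hb =>
    have hab := Submodule.mul_mem_mul ha hb
    rw [Submodule.span_mul_span] at hab
    refine Submodule.span_mono ?_ hab
    rintro _ ⟨a, ha, b, hb, rfl⟩
    exact mul_mem_linkedMonomials ha hb
  | star a hmem ha =>
    clear hmem
    induction ha using Submodule.span_induction with
    | mem a ha => exact Submodule.subset_span (star_mem_linkedMonomials ha)
    | zero => rw [star_zero]; exact zero_mem _
    | add a b _ _ ha hb => rw [star_add]; exact add_mem ha hb
    | smul c a _ ha => rw [star_smul]; exact Submodule.smul_mem _ _ ha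

/-- An element of `A(Y)` is a limit of linear combinations of linked monomials. -/
theorem exists_mem_span_linkedMonomials (a : orbitBreaking h Y) {ε : ℝ} (hε : 0 < ε) :
    ∃ b ∈ Submodule.span ℂ (linkedMonomials h Y), ‖(a : crossedProduct h) - b‖ < ε := by
  obtain ⟨b, hb, hab⟩ := Metric.mem_closure_iff.1 a.2 ε hε
  exact ⟨b, adjoin_le_span_linkedMonomials hb, by rwa [← dist_eq_norm]⟩

/-- The return bound forces `f = 0` when `|k| > N`, so the number of terms does not depend on `a`.
-/
theorem exists_eq_sum_of_mem_span {N : ℕ}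
    (hN : ∀ z, ∃ n : ℕ, 1 ≤ n ∧ n ≤ N ∧ (h ^ (n : ℤ)) z ∈ Y) {a : crossedProduct h}
    (ha : a ∈ Submodule.span ℂ (linkedMonomials h Y)) :
    ∃ g : ℤ → C(M, ℂ), (∀ k z, g k z ≠ 0 → Linked h Y z k) ∧
      a = ∑ k ∈ Finset.Icc (-N : ℤ) N,
        (unitaryGen h ^ k : unitary (crossedProduct h)) * ofFun h (g k) := by
  simp only [← ofFunHom_apply]
  induction ha using Submodule.span_induction with
  | mem a ha =>
    obtain ⟨k, f, hf, rfl⟩ := ha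
    refine ⟨Pi.single k f, fun m z hz => ?_, ?_⟩
    · obtain rfl | hm := eq_or_ne m k
      · rw [Pi.single_eq_same] at hz
        exact hf z hz
      · rw [Pi.single_eq_of_ne hm] at hz
        exact absurd rfl hz
    · by_cases hk : k ∈ Finset.Icc (-N : ℤ) N
      · rw [Finset.sum_eq_single_of_mem k hk, Pi.single_eq_same]
        · rfl
        · intro m _ hm
          rw [Pi.single_eq_of_ne hm, map_zero, mul_zero]
      · have hf0 : f = 0 := by
          ext z
          by_contra hz
          exact hk (Finset.mem_Icc.2 (_root_.abs_le.1 ((hf z hz).abs_le hN)))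
        subst hf0
        simp [← ofFunHom_apply]
  | zero => exact ⟨0, fun k z hz => absurd rfl hz, by simp⟩
  | add a b _ _ ha hb =>
    obtain ⟨f, hf, rfl⟩ := ha
    obtain ⟨g, hg, rfl⟩ := hb
    refine ⟨f + g, fun k z hz => ?_, ?_⟩
    · by_cases hz' : f k z = 0
      · exact hg k z fun h0 => hz (by simp [hz', h0])
      · exact hf k z hz'
    · simp [mul_add, Finset.sum_add_distrib]
  | smul c a _ ha =>
    obtain ⟨f, hf, rfl⟩ := ha
    refine ⟨c • f, fun k z hz => hf k z (right_ne_zero_of_mul hz), ?_⟩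
    simp [Finset.smul_sum]

/-- Different powers of `u` occupy different diagonals, so each `g k` can be read off separately. -/
theorem orbitCoeff_sum (g : ℤ → C(M, ℂ)) (N : ℕ) (x : M) (j k : ℤ)
    (hk : k ∈ Finset.Icc (-N : ℤ) N) :
    orbitCoeff h x (j + k) j (∑ k ∈ Finset.Icc (-N : ℤ) N,
        (unitaryGen h ^ k : unitary (crossedProduct h)) * ofFun h (g k)) = g k ((h ^ j) x) := by
  rw [map_sum, Finset.sum_eq_single_of_mem k hk]
  · rw [orbitCoeff_zpow_mul_ofFun, if_pos rfl]
  · intro m _ hm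
    rw [orbitCoeff_zpow_mul_ofFun, if_neg (by omega)]

/-- A linear combination of linked monomials is controlled by its matrix coefficients inside
the towers. -/
theorem norm_le_of_mem_span {N : ℕ}
    (hN : ∀ z, ∃ n : ℕ, 1 ≤ n ∧ n ≤ N ∧ (h ^ (n : ℤ)) z ∈ Y) {a : crossedProduct h}
    (ha : a ∈ Submodule.span ℂ (linkedMonomials h Y)) {c : ℝ} (hc : 0 ≤ c)
    (hac : ∀ x ∈ Y, ∀ n : ℕ, firstReturnTime h Y x = n → ∀ i j : Fin n,
      ‖orbitCoeff h x (i + 1) (j + 1) a‖ ≤ c) : ‖a‖ ≤ (2 * N + 1) * c := by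
  obtain ⟨g, hg, rfl⟩ := exists_eq_sum_of_mem_span hN ha
  have hgc : ∀ k ∈ Finset.Icc (-N : ℤ) N, ‖g k‖ ≤ c := by
    refine fun k hk => (ContinuousMap.norm_le _ hc).2 fun z => ?_
    obtain hz | hz := eq_or_ne (g k z) 0
    · rw [hz, norm_zero]; exact hc
    -- Placing `z` at level `j` over `x`, linkedness keeps `j + k` in the same tower, so `g k z` is
    -- an entry of that tower's block.
    obtain ⟨x, hx, n, j, hn, hj1, hjn, rfl⟩ := exists_eq_zpow_of_return hN z
    obtain ⟨h1, h2⟩ := (hg k _ hz).mem_Icc hx (firstReturnTime_eq_coe_iff.1 hn).2.1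
      (by exact_mod_cast hj1) (by exact_mod_cast hjn)
    have := hac x hx n hn ⟨(j + k - 1).toNat, by omega⟩ ⟨j - 1, by omega⟩
    have e1 : (((j + k - 1).toNat : ℕ) : ℤ) + 1 = j + k := by omega
    have e2 : ((j - 1 : ℕ) : ℤ) + 1 = j := by omega
    rwa [e1, e2, orbitCoeff_sum g N x j k hk] at this
  calc _ ≤ ∑ k ∈ Finset.Icc (-N : ℤ) N, c := by
        refine norm_sum_le_of_le _ fun k hk => ?_
        refine le_trans (le_of_eq ?_) ((norm_ofFun_le h (g k)).trans (hgc k hk))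
        exact CStarRing.norm_coe_unitary_mul _ _
    _ = (2 * N + 1) * c := by
        rw [Finset.sum_const, Int.card_Icc, nsmul_eq_mul]
        congr 1
        have : (((N : ℤ) + 1 - -N).toNat : ℤ) = 2 * N + 1 := by omega
        exact_mod_cast this

theorem orbitCoeff_eq_zero_of_linkedMonomials {a : crossedProduct h}
    (ha : a ∈ Submodule.span ℂ (linkedMonomials h Y)) {x : M} {n i j : ℤ} (hx : x ∈ Y)
    (hn : (h ^ n) x ∈ Y) (hj : j ∈ Finset.Icc 1 n) (hi : i ∉ Finset.Icc 1 n) :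
    orbitCoeff h x i j a = 0 := by
  induction ha using Submodule.span_induction with
  | mem a ha =>
    obtain ⟨k, f, hf, rfl⟩ := ha
    rw [orbitCoeff_zpow_mul_ofFun]
    split_ifs with hk
    · by_contra hz
      rw [Finset.mem_Icc] at hj
      exact hi (hk ▸ Finset.mem_Icc.2 ((hf _ hz).mem_Icc hx hn hj.1 hj.2))
    · rfl
  | zero => exact map_zero _
  | add a b _ _ ha hb => rw [map_add, ha, hb, add_zero]
  | smul c a _ ha => rw [map_smul, ha, smul_zero]

/-- The span of `e 1, …, e n` is invariant under `A(Y)` when `x` and `h ^ n (x)` are in `Y`. -/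
theorem orbitCoeff_eq_zero (a : orbitBreaking h Y) {x : M} {n i j : ℤ} (hx : x ∈ Y)
    (hn : (h ^ n) x ∈ Y) (hj : j ∈ Finset.Icc 1 n) (hi : i ∉ Finset.Icc 1 n) :
    orbitCoeff h x i j a = 0 := by
  refine norm_le_zero_iff.1 (le_of_forall_pos_lt_add fun ε hε => ?_)
  obtain ⟨b, hb, hab⟩ := exists_mem_span_linkedMonomials a hε
  have := (norm_orbitCoeff_le h x i j _).trans_lt hab
  rwa [map_sub, orbitCoeff_eq_zero_of_linkedMonomials hb hx hn hj hi, sub_zero, ← zero_add ε]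
    at this

/-- For a monomial the coefficient is `f ∘ h ^ j` or zero. Coefficients are bounded by the norm
uniformly in `x`, so continuity survives limits. -/
theorem continuous_orbitCoeff_left (a : orbitBreaking h Y) (i j : ℤ) :
    Continuous fun x => orbitCoeff h x i j a := by
  refine continuous_of_uniform_approx_of_continuous fun U hU => ?_
  obtain ⟨ε, hε, hεU⟩ := Metric.mem_uniformity_dist.1 hU
  obtain ⟨b, hb, hab⟩ := exists_mem_span_linkedMonomials a hε
  refine ⟨fun x => orbitCoeff h x i j b, ?_, fun x => hεU ?_⟩
  · clear hab
    induction hb using Submodule.span_induction with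
    | mem a ha =>
      obtain ⟨k, f, hf, rfl⟩ := ha
      simp only [orbitCoeff_zpow_mul_ofFun]
      split_ifs
      · exact f.continuous.comp (h ^ j).continuous
      · exact continuous_const
    | zero => simpa only [map_zero] using continuous_const
    | add a b _ _ ha hb => simp only [map_add]; exact ha.add hb
    | smul c a _ ha => simp only [map_smul]; exact ha.const_smul c
  · rw [dist_eq_norm, ← map_sub]
    exact (norm_orbitCoeff_le h x i j _).trans_lt hab

end LinkedMonomials

/-! ### Construction, uniqueness and injectivity of the homomorphism -/

section TowerHom

variable {M : Type u} [TopologicalSpace M] {h : M ≃ₜ M} {Y : Set M}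

/-- The first return time may drop at a limit point, but these two conditions are closed, and they
suffice for invariance of the block. -/
theorem mem_of_mem_towerBase (hY : IsClosed Y) {m : ℕ} {x : M} (hx : x ∈ towerBase h Y m) :
    x ∈ Y ∧ (h ^ (m : ℤ)) x ∈ Y := by
  have hclosed : IsClosed (Y ∩ (h ^ (m : ℤ)) ⁻¹' Y) :=
    hY.inter (hY.preimage (h ^ (m : ℤ)).continuous)
  refine closure_minimal ?_ hclosed hx
  exact fun y hy => ⟨hy.1, (firstReturnTime_eq_coe_iff.1 hy.2).2.1⟩

variable [CompactSpace M]

/-- The homomorphism `γ` on `A(Y)`: compression of the orbit representations to the towers. -/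
def towerHom (hY : IsClosed Y) {l : ℕ} (n : Fin (l + 1) → ℕ) :
    orbitBreaking h Y →⋆ₙₐ[ℂ] TowerAlgebra h Y n where
  toFun a k :=
    { toFun x := Matrix.of fun i j => orbitCoeff h x (i + 1) (j + 1) a
      continuous_toFun := continuous_matrix fun i j =>
        (continuous_orbitCoeff_left a _ _).comp continuous_subtype_val }
  map_smul' c a := by ext k x i j; exact map_smul (orbitCoeff h x (i + 1) (j + 1)) c _
  map_zero' := by ext k x i j; exact map_zero (orbitCoeff h x (i + 1) (j + 1))
  map_add' a b := by ext k x i j; exact map_add (orbitCoeff h x (i + 1) (j + 1)) _ _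
  map_star' a := by ext k x i j; exact orbitCoeff_star h x _ _ _
  map_mul' a b := by
    ext k x i j
    obtain ⟨hx, hxn⟩ := mem_of_mem_towerBase hY x.2
    have hinj : Function.Injective fun l : Fin (n k) => ((l : ℕ) : ℤ) + 1 := fun l l' hl => by
      simpa [Fin.ext_iff] using hl
    refine (orbitCoeff_mul h x _ _ _ _ (Finset.univ.map ⟨_, hinj⟩) fun l hl => ?_).trans ?_
    · refine orbitCoeff_eq_zero b hx hxn (Finset.mem_Icc.2 (by omega)) fun hl' => hl ?_
      rw [Finset.mem_Icc] at hl'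
      exact Finset.mem_map.2 ⟨⟨(l - 1).toNat, by omega⟩, Finset.mem_univ _, by simp; omega⟩
    · rw [Finset.sum_map]
      rfl

theorem towerHom_fn (hY : IsClosed Y) {l : ℕ} (n : Fin (l + 1) → ℕ) (f : C(M, ℂ))
    (k : Fin (l + 1)) : towerHom hY n (orbitBreaking.fn h Y f) k = towerDiag h Y (n k) f := by
  ext x i j
  have := orbitCoeff_zpow_mul_ofFun h x (i + 1) (j + 1) 0 f
  rw [zpow_zero, OneMemClass.coe_one, one_mul] at this
  refine this.trans ?_
  change _ = Matrix.diagonal (fun j : Fin (n k) => f (h^[(j : ℕ) + 1] (x : M))) i j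
  rw [Matrix.diagonal_apply, ← zpow_natCast_apply]
  by_cases hij : i = j
  · subst hij; simp
  · rw [if_neg hij, if_neg]
    contrapose! hij
    exact Fin.ext (by omega)

theorem isTowerHom_towerHom (hY : IsClosed Y) {l : ℕ} (n : Fin (l + 1) → ℕ) :
    IsTowerHom h Y n (towerHom hY n) := by
  refine ⟨towerHom_fn hY n, fun f hf k => ?_⟩
  rw [towerHom_fn]
  ext x i j
  have := orbitCoeff_zpow_mul_ofFun h x (i + 1) (j + 1) 1 f
  rw [zpow_one] at this
  refine this.trans ?_
  change _ = (shiftMatrix (n k) *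
    Matrix.diagonal (fun j : Fin (n k) => f (h^[(j : ℕ) + 1] (x : M)))) i j
  rw [Matrix.mul_diagonal, ← zpow_natCast_apply, shiftMatrix, Matrix.of_apply, ite_mul, one_mul,
    zero_mul, Nat.cast_add, Nat.cast_one]
  rcases (show (j : ℕ) + 1 ≤ n k from j.2).lt_or_eq with hj | hj
  · rw [Nat.mod_eq_of_lt hj]
    congr 1
    exact propext (by omega)
  -- In the last column the bilateral shift leaves the block while the cyclic shift wraps around;
  -- both entries vanish because `h ^ n(k) x` lies in `Y`.
  · have h0 : f ((h ^ ((j : ℕ) + 1 : ℤ)) x) = 0 := by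
      refine hf _ ?_
      have := (mem_of_mem_towerBase hY x.2).2
      have e : ((n k : ℕ) : ℤ) = (j : ℕ) + 1 := by omega
      rwa [e] at this
    rw [h0, ite_self, ite_self]

theorem orbitBreaking.fn_one : orbitBreaking.fn h Y 1 = 1 :=
  Subtype.ext (map_one (ofFunHom h))

theorem IsTowerHom.map_one {l : ℕ} {n : Fin (l + 1) → ℕ}
    {γ : orbitBreaking h Y →⋆ₙₐ[ℂ] TowerAlgebra h Y n} (hγ : IsTowerHom h Y n γ) : γ 1 = 1 := by
  rw [← orbitBreaking.fn_one]
  funext k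
  rw [hγ.1]
  ext x i j
  change Matrix.diagonal (fun j : Fin (n k) => (1 : ℂ)) i j = (1 : Matrix _ _ ℂ) i j
  rw [Matrix.diagonal_one]

section

open scoped Matrix.Norms.L2Operator

/-- The operator norm makes matrices a C⋆-algebra, where ⋆-homomorphisms are contractive. -/
theorem continuous_nonUnitalStarAlgHom_matrix {A m : Type*} [NonUnitalCStarAlgebra A] [Fintype m]
    [DecidableEq m] (φ : A →⋆ₙₐ[ℂ] Matrix m m ℂ) : Continuous φ :=
  AddMonoidHomClass.continuous_of_bound φ 1 fun a => by
    rw [one_mul]; exact NonUnitalStarAlgHom.norm_apply_le φ a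

end

instance isClosed_crossedProduct : IsClosed (crossedProduct h : Set (BoundedFamilies h)) :=
  StarSubalgebra.isClosed_topologicalClosure _

instance isClosed_orbitBreaking : IsClosed (orbitBreaking h Y : Set (crossedProduct h)) :=
  StarSubalgebra.isClosed_topologicalClosure _

theorem continuous_towerAlgebra_apply {l : ℕ} {n : Fin (l + 1) → ℕ}
    (γ : orbitBreaking h Y →⋆ₙₐ[ℂ] TowerAlgebra h Y n) (k : Fin (l + 1))
    (x : towerBase h Y (n k)) : Continuous fun a => γ a k x := by
  let ev : TowerAlgebra h Y n →⋆ₙₐ[ℂ] Matrix (Fin (n k)) (Fin (n k)) ℂ :=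
    { toFun F := F k x
      map_smul' _ _ := rfl
      map_zero' := rfl
      map_add' _ _ := rfl
      map_mul' _ _ := rfl
      map_star' _ := rfl }
  exact continuous_nonUnitalStarAlgHom_matrix (A := orbitBreaking h Y) (ev.comp γ)

theorem IsTowerHom.unique {l : ℕ} {n : Fin (l + 1) → ℕ}
    {γ γ' : orbitBreaking h Y →⋆ₙₐ[ℂ] TowerAlgebra h Y n} (hγ : IsTowerHom h Y n γ)
    (hγ' : IsTowerHom h Y n γ') : γ = γ' := by
  have key : ∀ a ∈ StarAlgebra.adjoin ℂ (Set.range (ofFun h) ∪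
      {a | ∃ f : C(M, ℂ), (∀ y ∈ Y, f y = 0) ∧ a = implUnitary h * ofFun h f}),
      -- The maps are defined only on `A(Y)`, so the induction carries a lift of `a` to it.
      ∃ b : orbitBreaking h Y, (b : crossedProduct h) = a ∧ γ b = γ' b := by
    intro a ha
    induction ha using StarAlgebra.adjoin_induction with
    | mem a ha =>
      rcases ha with ⟨f, rfl⟩ | ⟨f, hf, rfl⟩
      · exact ⟨orbitBreaking.fn h Y f, rfl, funext fun k => (hγ.1 f k).trans (hγ'.1 f k).symm⟩
      · refine ⟨orbitBreaking.ufn h Y f hf, rfl, funext fun k => ?_⟩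
        rw [hγ.2, hγ'.2, hγ.1, hγ'.1]
    | algebraMap r =>
      refine ⟨r • 1, (Algebra.algebraMap_eq_smul_one r).symm, ?_⟩
      rw [map_smul, map_smul, hγ.map_one, hγ'.map_one]
    | add a b _ _ iha ihb =>
      obtain ⟨a, rfl, ha⟩ := iha
      obtain ⟨b, rfl, hb⟩ := ihb
      exact ⟨a + b, rfl, by rw [map_add, map_add, ha, hb]⟩
    | mul a b _ _ iha ihb =>
      obtain ⟨a, rfl, ha⟩ := iha
      obtain ⟨b, rfl, hb⟩ := ihb
      exact ⟨a * b, rfl, by rw [map_mul, map_mul, ha, hb]⟩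
    | star a _ iha =>
      obtain ⟨a, rfl, ha⟩ := iha
      exact ⟨star a, rfl, by rw [map_star, map_star, ha]⟩
  refine NonUnitalStarAlgHom.ext fun a => ?_
  funext k
  refine ContinuousMap.ext fun x => ?_
  have hdense : DenseRange (Set.inclusion (StarSubalgebra.le_topologicalClosure
      (StarAlgebra.adjoin ℂ (Set.range (ofFun h) ∪
        {a | ∃ f : C(M, ℂ), (∀ y ∈ Y, f y = 0) ∧ a = implUnitary h * ofFun h f})))) :=
    denseRange_inclusion_iff _ |>.2 subset_rfl
  refine congrFun (hdense.equalizer (continuous_towerAlgebra_apply γ k x)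
    (continuous_towerAlgebra_apply γ' k x) (funext fun b => ?_)) a
  obtain ⟨c, hc, hcγ⟩ := key b b.2
  obtain rfl : c = Set.inclusion (StarSubalgebra.le_topologicalClosure _) b := Subtype.ext hc
  exact congrArg (fun F : TowerAlgebra h Y n => F k x) hcγ

theorem injective_towerHom (hY : IsClosed Y) {l : ℕ} {n : Fin (l + 1) → ℕ} {N : ℕ}
    (hN : ∀ z, ∃ n : ℕ, 1 ≤ n ∧ n ≤ N ∧ (h ^ (n : ℤ)) z ∈ Y)
    (hn : ∀ x ∈ Y, ∃ k, firstReturnTime h Y x = n k) :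
    Function.Injective (towerHom (h := h) hY n) := by
  refine (injective_iff_map_eq_zero _).2 fun a ha => Subtype.ext (norm_le_zero_iff.1 ?_)
  have hbound : ∀ ε > 0, ‖(a : crossedProduct h)‖ ≤ (2 * N + 2) * ε := by
    intro ε hε
    obtain ⟨b, hb, hab⟩ := exists_mem_span_linkedMonomials a hε
    have hbε : ‖b‖ ≤ (2 * N + 1) * ε := by
      refine norm_le_of_mem_span hN hb hε.le fun x hx m hm i j => ?_
      obtain ⟨k, hk⟩ := hn x hx
      obtain rfl : m = n k := by exact_mod_cast hm.symm.trans hk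
      -- The tower coefficients of `a` vanish, so those of `b` are those of `b - a`, hence at most
      -- `ε`.
      have h0 := congrArg (fun F : TowerAlgebra h Y n => F k ⟨x, subset_closure ⟨hx, hm⟩⟩ i j) ha
      have h1 : orbitCoeff h x (i + 1) (j + 1) a = 0 := h0
      have := (norm_orbitCoeff_le h x (i + 1) (j + 1) _).trans hab.le
      rwa [map_sub, h1, zero_sub, norm_neg] at this
    calc ‖(a : crossedProduct h)‖ = ‖((a : crossedProduct h) - b) + b‖ := by rw [sub_add_cancel]
      _ ≤ ε + (2 * N + 1) * ε := (norm_add_le _ _).trans (add_le_add hab.le hbε)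
      _ = (2 * N + 2) * ε := by ring
  refine le_of_forall_pos_le_add fun δ hδ => ?_
  refine (hbound (δ / (2 * N + 2)) (by positivity)).trans ?_
  rw [mul_div_cancel₀ _ (by positivity), zero_add]

end TowerHom

/-! ### Enumeration of the return times and conclusion -/

theorem exists_strictMono_range_eq {S : Set ℕ∞} (hS : S.Nonempty) {N : ℕ}
    (hN : ∀ s ∈ S, ∃ n : ℕ, n ≤ N ∧ s = n) :
    ∃ (l : ℕ) (n : Fin (l + 1) → ℕ), StrictMono n ∧ Set.range (fun k => (n k : ℕ∞)) = S := by
  classical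
  set T : Finset ℕ := (Finset.range (N + 1)).filter fun n => (n : ℕ∞) ∈ S with hT
  have hTS : ∀ m : ℕ, m ∈ T ↔ (m : ℕ∞) ∈ S := fun m => by
    rw [hT, Finset.mem_filter, Finset.mem_range, and_iff_right_iff_imp]
    intro hm
    obtain ⟨n, hn, hmn⟩ := hN _ hm
    obtain rfl : m = n := by exact_mod_cast hmn
    omega
  have hpos : 0 < T.card := by
    obtain ⟨s, hs⟩ := hS
    obtain ⟨n, -, rfl⟩ := hN s hs
    exact Finset.card_pos.2 ⟨n, (hTS n).2 hs⟩
  refine ⟨T.card - 1, T.orderEmbOfFin (by omega), OrderEmbedding.strictMono _, ?_⟩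
  have hrange := Finset.range_orderEmbOfFin T (show T.card = T.card - 1 + 1 by omega)
  ext s
  constructor
  · rintro ⟨k, rfl⟩
    exact (hTS _).1 (Finset.orderEmbOfFin_mem T _ k)
  · intro hs
    obtain ⟨n, -, rfl⟩ := hN s hs
    obtain ⟨k, hk⟩ := hrange.ge (Finset.mem_coe.2 ((hTS n).2 hs))
    exact ⟨k, congrArg _ hk⟩

end MinimalCrossedProduct
end

open MinimalCrossedProduct
theorem proposition2p3 {M : Type*} [MetricSpace M] [CompactSpace M] (h : M ≃ₜ M)
    (hmin : IsMinimalHomeo h) (Y : Set M) (hY : IsClosed Y) (hYint : (interior Y).Nonempty) :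
    ∃ (l : ℕ) (n : Fin (l + 1) → ℕ),
      StrictMono n ∧
      Set.range (fun k => (n k : ℕ∞)) = firstReturnTime h Y '' Y ∧
      ∃ γ : orbitBreaking h Y →⋆ₙₐ[ℂ] TowerAlgebra h Y n,
        IsTowerHom h Y n γ ∧
        (∀ γ' : orbitBreaking h Y →⋆ₙₐ[ℂ] TowerAlgebra h Y n, IsTowerHom h Y n γ' → γ' = γ) ∧
        γ 1 = 1 ∧
        Function.Injective γ := by
  obtain ⟨N, hN⟩ := hmin.exists_return_bound hYint
  obtain ⟨l, n, hn, hrange⟩ := exists_strictMono_range_eq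
    ((hYint.mono interior_subset).image (firstReturnTime h Y)) (N := N) (by
      rintro _ ⟨x, -, rfl⟩
      exact exists_firstReturnTime_eq hN x)
  have hγ := isTowerHom_towerHom (h := h) hY n
  refine ⟨l, n, hn, hrange, towerHom hY n, hγ, fun γ' hγ' => hγ'.unique hγ, hγ.map_one,
    injective_towerHom hY hN fun x hx => ?_⟩
  obtain ⟨k, hk⟩ := hrange.ge (Set.mem_image_of_mem _ hx)
  exact ⟨k, hk.symm⟩
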